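/- Let $G$ be a finite group, $p$ a prime (not necessarily dividing $|G|$), and $k$ an algebraically closed field of characteristic $p$. All $kG$-modules are finitely generated; write $k$ also for the trivial module. A vertex of an indecomposable $kG$-module $U$ is a subgroup $H \le G$ that is minimal (with respect to inclusion) with the property that $U$ is isomorphic to a direct summand of $\operatorname{Ind}_H^G \operatorname{Res}^G_H U$. A Sylow-vertex component of a $kG$-module $M$ is a $kG$-module $U$ that is indecomposable, isomorphic to a direct summand of $M$, and has a Sylow $p$-subgroup of $G$ as a vertex. A $p$-permutation module is a direct summand of a $kG$-module that has a $k$-basis permuted by $G$. A $kG$-module $M$ is a Dade module if $\operatorname{End}_k(M) \cong k^n \oplus W$ as $kG$-modules (with $G$ acting on $\operatorname{End}_k(M)$ by conjugation) for some integer $n \ge 0$ and some $p$-permutation module $W$ without Sylow-vertex components. A Dade module is capped if it has a Sylow-vertex component. **Proposition.** Let $M$ be a capped Dade $kG$-module. If $U$ and $V$ are two Sylow-vertex components of $M$, then $U \cong V$. Consequently $M$ has a Sylow-vertex component (a cap of $M$), and it is unique up to isomorphism. -/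

import Mathlib

namespace DadeModule

open Representation

section

variable {k G : Type*} [Field k] [Group G]
  {U V : Type*} [AddCommGroup U] [Module k U] [AddCommGroup V] [Module k V]

/-- `U ∣ V`: the `kG`-module `U` is isomorphic to a direct summand of the `kG`-module `V`,
i.e. `V` is the internal direct sum of two subrepresentations, the first isomorphic to `U`. -/
def IsSummand (σ : Representation k G U) (ρ : Representation k G V) : Prop :=
  ∃ A B : Subrepresentation ρ, IsCompl A B ∧ Nonempty (σ.Equiv A.toRepresentation)

/-- A `kG`-module is indecomposable if it is nonzero and is not the direct sum of two nonzero
submodules. -/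
def IsIndecomposable (ρ : Representation k G V) : Prop :=
  Nontrivial V ∧ ∀ A B : Subrepresentation ρ, IsCompl A B → A = ⊥ ∨ B = ⊥

/-- A component of `V` is an indecomposable direct summand of `V`. -/
def IsComponent (σ : Representation k G U) (ρ : Representation k G V) : Prop :=
  IsIndecomposable σ ∧ IsSummand σ ρ

/-- The restriction of a `kG`-module to a subgroup. -/
def res (H : Subgroup G) (ρ : Representation k G V) : Representation k H V :=
  ρ.comp H.subtype

/-- `H` is a vertex of the (indecomposable) `kG`-module `V`: it is minimal among the subgroups `H`
of `G` such that `V` is a direct summand of `Ind_H^G Res_H^G V`. -/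
def IsVertex (ρ : Representation k G V) (H : Subgroup G) : Prop :=
  Minimal (fun K : Subgroup G => IsSummand ρ (ind K.subtype (res K ρ))) H

/-- A (finitely generated) permutation `kG`-module: there is a `k`-basis permuted by `G`. -/
def IsPermutation (ρ : Representation k G V) : Prop :=
  ∃ (n : ℕ) (b : Module.Basis (Fin n) k V), ∀ (g : G) (i : Fin n), ∃ j : Fin n, ρ g (b i) = b j

/-- A `p`-permutation `kG`-module, where `p` is the characteristic of `k`: a direct summand of a
(finitely generated) permutation `kG`-module. The ambient permutation module, being
finite-dimensional, is taken to live on some `k ^ m`. -/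
def IsPPermutation (ρ : Representation k G V) : Prop :=
  ∃ (m : ℕ) (π : Representation k G (Fin m → k)), IsPermutation π ∧ IsSummand ρ π

/-- `U` is a Sylow-vertex component of `V`: an indecomposable direct summand of `V` having a Sylow
`p`-subgroup of `G` as a vertex. -/
def IsSylowVertexComponent (p : ℕ) (σ : Representation k G U) (ρ : Representation k G V) : Prop :=
  IsComponent σ ρ ∧ ∃ S : Sylow p G, IsVertex σ (S : Subgroup G)

end

section

universe u v w

variable {k : Type u} {G : Type v} [Field k] [Group G] {V : Type w} [AddCommGroup V] [Module k V]

/-- A Dade `kG`-module: `End_k(V) ≅ kⁿ ⊕ W` for some `n ≥ 0` and some `p`-permutation module `W`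
none of whose components has a Sylow `p`-subgroup as a vertex. Here `End_k(V)` carries the
conjugation action and `kⁿ` the trivial action. -/
def IsDade (p : ℕ) (ρ : Representation k G V) : Prop :=
  ∃ (n : ℕ) (W : Type w) (_ : AddCommGroup W) (_ : Module k W) (τ : Representation k G W),
    Nonempty ((linHom ρ ρ).Equiv ((trivial k G (Fin n → k)).prod τ)) ∧
    IsPPermutation τ ∧
    ∀ A : Subrepresentation τ, ¬ IsSylowVertexComponent p A.toRepresentation τ

/-- A capped Dade `kG`-module: a Dade module that has a Sylow-vertex component. -/
def IsCappedDade (p : ℕ) (ρ : Representation k G V) : Prop :=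
  IsDade p ρ ∧ ∃ A : Subrepresentation ρ, IsSylowVertexComponent p A.toRepresentation ρ

end

end DadeModule

namespace DadeModule

open Representation

section

variable {k G : Type*} [Field k] [Group G]
  {U V W X Y : Type*} [AddCommGroup U] [Module k U] [AddCommGroup V] [Module k V]
  [AddCommGroup W] [Module k W] [AddCommGroup X] [Module k X] [AddCommGroup Y] [Module k Y]

theorem intertwiningMap_comm {σ : Representation k G U} {ρ : Representation k G V}
    (f : IntertwiningMap σ ρ) (g : G) (u : U) : f (σ g u) = ρ g (f u) :=
  LinearMap.congr_fun (f.isIntertwining' g) u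

/-- The projection onto a direct summand along a complement. -/
theorem exists_projection_of_isCompl {ρ : Representation k G V} {A B : Subrepresentation ρ}
    (hAB : IsCompl A B) : ∃ r : IntertwiningMap ρ A.toRepresentation,
      (∀ a : A.toSubmodule, r a = a) ∧ ∀ b ∈ B, r b = 0 := by
  have hc : IsCompl A.toSubmodule B.toSubmodule := by
    refine ⟨disjoint_iff.2 ?_, codisjoint_iff.2 ?_⟩
    · exact congrArg Subrepresentation.toSubmodule (disjoint_iff.1 hAB.disjoint)
    · exact congrArg Subrepresentation.toSubmodule (codisjoint_iff.1 hAB.codisjoint)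
  let P : V →ₗ[k] A.toSubmodule := A.toSubmodule.projectionOnto B.toSubmodule hc
  have h1 : ∀ a : A.toSubmodule, P a = a := Submodule.projectionOnto_apply_left hc
  have h2 : ∀ b ∈ B, P b = 0 := fun b hb => (Submodule.projectionOnto_apply_eq_zero_iff hc).2 hb
  refine ⟨⟨P, fun g => ?_⟩, h1, h2⟩
  ext1 v
  obtain ⟨a, ha, b, hb, rfl⟩ := Submodule.mem_sup.1
    (hc.sup_eq_top ▸ Submodule.mem_top : v ∈ A.toSubmodule ⊔ B.toSubmodule)
  have h3 : P (ρ g a) = A.toRepresentation g ⟨a, ha⟩ :=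
    h1 (A.toRepresentation g ⟨a, ha⟩)
  rw [LinearMap.comp_apply, LinearMap.comp_apply, map_add, map_add, map_add, h1 ⟨a, ha⟩, h3,
    h2 b hb, h2 _ (B.apply_mem_toSubmodule g hb), add_zero, add_zero]

/-- The inclusion of a subrepresentation. -/
def inclusion {ρ : Representation k G V} (A : Subrepresentation ρ) :
    IntertwiningMap A.toRepresentation ρ :=
  ⟨A.toSubmodule.subtype, fun _ => rfl⟩

/-- A representation is a direct summand if and only if it is a retract. -/
theorem isSummand_iff_exists_retraction {σ : Representation k G U} {ρ : Representation k G V} :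
    IsSummand σ ρ ↔ ∃ (i : IntertwiningMap σ ρ) (r : IntertwiningMap ρ σ), ∀ u, r (i u) = u := by
  constructor
  · rintro ⟨A, B, hAB, ⟨e⟩⟩
    obtain ⟨r, hr, -⟩ := exists_projection_of_isCompl hAB
    refine ⟨(inclusion A).comp e.toIntertwiningMap, e.symm.toIntertwiningMap.comp r, fun u => ?_⟩
    change e.symm (r (e u : V)) = u
    rw [hr]
    exact e.symm_apply_apply u
  · rintro ⟨i, r, h⟩
    have hi : Function.Injective i := fun a b hab => by rw [← h a, hab, h b]
    refine ⟨i.range, r.ker, ⟨disjoint_iff.2 ?_, codisjoint_iff.2 ?_⟩, ⟨Representation.Equiv.mk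
      (LinearEquiv.ofInjective i.toLinearMap hi) fun g => ?_⟩⟩
    · apply Subrepresentation.toSubmodule_injective
      change i.range.toSubmodule ⊓ r.ker.toSubmodule = ⊥
      rw [eq_bot_iff]
      rintro _ ⟨⟨u, rfl⟩, hv⟩
      have hv' : r (i u) = 0 := hv
      rw [h] at hv'
      rw [hv']
      exact (map_zero i.toLinearMap)
    · apply Subrepresentation.toSubmodule_injective
      change i.range.toSubmodule ⊔ r.ker.toSubmodule = ⊤
      rw [eq_top_iff]
      intro v _
      refine Submodule.mem_sup.2 ⟨i (r v), ⟨r v, rfl⟩, v - i (r v), ?_, by abel⟩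
      change r (v - i (r v)) = 0
      rw [map_sub, h, sub_self]
    · ext u
      exact intertwiningMap_comm i g u

theorem isSummand_trans {σ : Representation k G U} {ρ : Representation k G V}
    {τ : Representation k G W} (h : IsSummand σ ρ) (h' : IsSummand ρ τ) : IsSummand σ τ := by
  obtain ⟨i, r, hir⟩ := isSummand_iff_exists_retraction.1 h
  obtain ⟨i', r', hir'⟩ := isSummand_iff_exists_retraction.1 h'
  refine isSummand_iff_exists_retraction.2 ⟨i'.comp i, r.comp r', fun u => ?_⟩
  change r (r' (i' (i u))) = u
  rw [hir', hir]

theorem isSummand_toRepresentation_of_isCompl {ρ : Representation k G V} {A B : Subrepresentation ρ}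
    (h : IsCompl A B) : IsSummand A.toRepresentation ρ :=
  ⟨A, B, h, ⟨Representation.Equiv.refl _⟩⟩

theorem mem_invariants_linHom_iff {σ : Representation k G U} {ρ : Representation k G V}
    {f : U →ₗ[k] V} : f ∈ (linHom σ ρ).invariants ↔ ∀ g u, f (σ g u) = ρ g (f u) := by
  constructor
  · intro h g u
    have := LinearMap.congr_fun (h g) (σ g u)
    simpa using this.symm
  · intro h g
    ext u
    rw [linHom_apply, LinearMap.comp_apply, LinearMap.comp_apply, h, ← Module.End.mul_apply,
      ← map_mul, mul_inv_cancel, map_one, Module.End.one_apply]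

theorem intertwiningMap_mem_invariants {σ : Representation k G U} {ρ : Representation k G V}
    (f : IntertwiningMap σ ρ) : f.toLinearMap ∈ (linHom σ ρ).invariants :=
  mem_invariants_linHom_iff.2 f.isIntertwining

/-- Composition on both sides with homomorphisms of representations. -/
def linHomMap {σ : Representation k G U} {τ : Representation k G V} {σ' : Representation k G W}
    {τ' : Representation k G X} (a : IntertwiningMap σ' σ) (b : IntertwiningMap τ τ') :
    IntertwiningMap (linHom σ τ) (linHom σ' τ') where
  toLinearMap := (LinearMap.lcomp k X a.toLinearMap) ∘ₗ (LinearMap.llcomp k U V X b.toLinearMap)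
  isIntertwining' g := by
    ext f u
    have h1 := intertwiningMap_comm a g⁻¹ u
    have h2 := intertwiningMap_comm b g (f (σ g⁻¹ (a u)))
    simp [h1, h2]

section RelTrace

variable [Finite G]

/-- The relative trace from a subgroup: on vectors fixed by `Q` it is the sum over the
`G`-translates. -/
noncomputable def relTrace (Q : Subgroup G) (ρ : Representation k G V) : V →ₗ[k] V :=
  letI := Fintype.ofFinite (G ⧸ Q)
  ∑ c : G ⧸ Q, ρ c.out

theorem relTrace_apply (Q : Subgroup G) [Fintype (G ⧸ Q)] (ρ : Representation k G V) (v : V) :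
    relTrace Q ρ v = ∑ c : G ⧸ Q, ρ c.out v := by
  rw [relTrace, LinearMap.sum_apply]
  congr!

theorem intertwiningMap_map_relTrace {σ : Representation k G U} {ρ : Representation k G V}
    (f : IntertwiningMap σ ρ) (Q : Subgroup G) (u : U) :
    f (relTrace Q σ u) = relTrace Q ρ (f u) := by
  have := Fintype.ofFinite (G ⧸ Q)
  rw [relTrace_apply, relTrace_apply, map_sum]
  exact Finset.sum_congr rfl fun c _ => intertwiningMap_comm f _ _

omit [Finite G] in
theorem apply_out_of_mem_invariants {Q : Subgroup G} {ρ : Representation k G V} {v : V}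
    (hv : v ∈ (res Q ρ).invariants) (g : G) : ρ (g : G ⧸ Q).out v = ρ g v := by
  obtain ⟨q, hq⟩ := QuotientGroup.mk_out_eq_mul Q g
  rw [hq, map_mul]
  exact congrArg (ρ g) (hv q)

theorem relTrace_mem_invariants {Q : Subgroup G} {ρ : Representation k G V} {v : V}
    (hv : v ∈ (res Q ρ).invariants) : relTrace Q ρ v ∈ ρ.invariants := by
  have := Fintype.ofFinite (G ⧸ Q)
  intro g
  rw [relTrace_apply, map_sum]
  refine Fintype.sum_equiv (MulAction.toPerm g) _ _ fun c => ?_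
  have h : MulAction.toPerm g c = ((g * c.out : G) : G ⧸ Q) := by
    rw [MulAction.toPerm_apply]
    conv_lhs => rw [← QuotientGroup.out_eq' c]
    rfl
  rw [h, apply_out_of_mem_invariants hv, map_mul]
  rfl

theorem relTrace_of_mem_invariants (Q : Subgroup G) {ρ : Representation k G V} {v : V}
    (hv : v ∈ ρ.invariants) : relTrace Q ρ v = (Q.index : k) • v := by
  have := Fintype.ofFinite (G ⧸ Q)
  rw [relTrace_apply, Finset.sum_congr rfl fun c _ => hv _, Finset.sum_const, Finset.card_univ,
    Subgroup.index, Nat.card_eq_fintype_card, Nat.cast_smul_eq_nsmul]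

omit [Finite G] in
theorem intertwiningMap_map_mem_invariants_res {σ : Representation k G U}
    {ρ : Representation k G V} (f : IntertwiningMap σ ρ) {Q : Subgroup G} {u : U}
    (hu : u ∈ (res Q σ).invariants) : f u ∈ (res Q ρ).invariants := by
  intro q
  have := intertwiningMap_comm f q u
  exact this.symm.trans (congrArg f (hu q))

omit [Finite G] in
theorem invariants_le_invariants_res (Q : Subgroup G) (ρ : Representation k G V) :
    ρ.invariants ≤ (res Q ρ).invariants := fun _ hv q => hv q

/-- The sum of the images of the relative traces from the proper subgroups of `S`. -/
noncomputable def traceIdeal (S : Subgroup G) (ρ : Representation k G V) : Submodule k V :=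
  ⨆ Q : Set.Iio S, (res (Q : Subgroup G) ρ).invariants.map (relTrace (Q : Subgroup G) ρ)

theorem relTrace_mem_traceIdeal {Q S : Subgroup G} (hQ : Q < S) {ρ : Representation k G V} {v : V}
    (hv : v ∈ (res Q ρ).invariants) : relTrace Q ρ v ∈ traceIdeal S ρ :=
  Submodule.mem_iSup_of_mem (⟨Q, hQ⟩ : Set.Iio S) (Submodule.mem_map_of_mem hv)

theorem traceIdeal_le {S : Subgroup G} {ρ : Representation k G V} {N : Submodule k V}
    (h : ∀ Q < S, ∀ v ∈ (res Q ρ).invariants, relTrace Q ρ v ∈ N) : traceIdeal S ρ ≤ N :=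
  iSup_le fun Q => Submodule.map_le_iff_le_comap.2 fun v hv => h Q Q.2 v hv

theorem intertwiningMap_map_mem_traceIdeal {σ : Representation k G U} {ρ : Representation k G V}
    (f : IntertwiningMap σ ρ) {S : Subgroup G} {u : U} (hu : u ∈ traceIdeal S σ) :
    f u ∈ traceIdeal S ρ := by
  suffices traceIdeal S σ ≤ (traceIdeal S ρ).comap f.toLinearMap from this hu
  refine traceIdeal_le fun Q hQ v hv => ?_
  have := intertwiningMap_map_relTrace f Q v
  change f (relTrace Q σ v) ∈ traceIdeal S ρ
  rw [this]
  exact relTrace_mem_traceIdeal hQ (intertwiningMap_map_mem_invariants_res f hv)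

end RelTrace

section Higman

/-- The linear map out of an induced representation with prescribed components. -/
noncomputable def indLift {H : Type*} [Group H] {φ : H →* G} {σ : Representation k H U}
    (F : G → U →ₗ[k] V) (hF : ∀ h g u, F (φ h * g) (σ h u) = F g u) : IndV φ σ →ₗ[k] V :=
  Coinvariants.lift _
    (TensorProduct.lift <| (Finsupp.lift _ _ _ F) ∘ₗ (MonoidAlgebra.coeffLinearEquiv k).toLinearMap)
    fun h => by
      ext g u
      simp [hF]

theorem indLift_mk {H : Type*} [Group H] {φ : H →* G} {σ : Representation k H U}
    (F : G → U →ₗ[k] V) (hF : ∀ h g u, F (φ h * g) (σ h u) = F g u) (g : G) (u : U) :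
    indLift F hF (IndV.mk φ σ g u) = F g u := by
  simp [indLift]

theorem indV_mk_mul {H : Type*} [Group H] {φ : H →* G} {σ : Representation k H U}
    (h : H) (g : G) (u : U) : IndV.mk φ σ (φ h * g) (σ h u) = IndV.mk φ σ g u := by
  have := Coinvariants.mk_self_apply (Representation.tprod ((leftRegular k G).comp φ) σ) h
    (TensorProduct.tmul k (MonoidAlgebra.single g 1) u)
  simpa using this

variable [Finite G]

/-- Higman's criterion, sufficiency. -/
theorem isSummand_ind_of_relTrace_eq_id {Q : Subgroup G} {ρ : Representation k G V}
    {f : V →ₗ[k] V} (hf : f ∈ (res Q (linHom ρ ρ)).invariants)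
    (h : relTrace Q (linHom ρ ρ) f = LinearMap.id) :
    IsSummand ρ (ind Q.subtype (res Q ρ)) := by
  have hF : ∀ (q : Q) (g : G) (u : V), ρ (Q.subtype q * g)⁻¹ (res Q ρ q u) = ρ g⁻¹ u := by
    intro q g u
    change (ρ (q * g : G)⁻¹) (ρ q u) = ρ g⁻¹ u
    rw [← Module.End.mul_apply, ← map_mul, mul_inv_rev, inv_mul_cancel_right]
  let R : IndV Q.subtype (res Q ρ) →ₗ[k] V := indLift (fun g => ρ g⁻¹) hF
  have hR : ∀ g u, R (IndV.mk Q.subtype (res Q ρ) g u) = ρ g⁻¹ u := fun g u => indLift_mk _ hF g u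
  let r : IntertwiningMap (ind Q.subtype (res Q ρ)) ρ := ⟨R, fun g => by
    refine IndV.hom_ext _ _ fun x => LinearMap.ext fun u => ?_
    change R (ind Q.subtype (res Q ρ) g (IndV.mk Q.subtype (res Q ρ) x u)) =
      ρ g (R (IndV.mk Q.subtype (res Q ρ) x u))
    rw [ind_mk, hR, hR, mul_inv_rev, inv_inv, map_mul, Module.End.mul_apply]⟩
  let y : V →ₗ[k] IndV Q.subtype (res Q ρ) := IndV.mk Q.subtype (res Q ρ) 1 ∘ₗ f
  have hy : y ∈ (res Q (linHom ρ (ind Q.subtype (res Q ρ)))).invariants := by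
    intro q
    ext u
    have h1 : ρ q (f (ρ (q : G)⁻¹ u)) = f u := LinearMap.congr_fun (hf q) u
    change ind Q.subtype (res Q ρ) (q : G) (IndV.mk Q.subtype (res Q ρ) 1 (f (ρ (q : G)⁻¹ u))) =
      IndV.mk Q.subtype (res Q ρ) 1 (f u)
    rw [ind_mk, ← h1, ← indV_mk_mul q⁻¹ 1 (ρ q (f (ρ (q : G)⁻¹ u)))]
    simp [res]
  let i : IntertwiningMap ρ (ind Q.subtype (res Q ρ)) :=
    ⟨relTrace Q _ y, fun g => by
      ext u
      exact mem_invariants_linHom_iff.1 (relTrace_mem_invariants hy) g u⟩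
  refine isSummand_iff_exists_retraction.2 ⟨i, r, fun u => ?_⟩
  have h2 := intertwiningMap_map_relTrace (linHomMap (IntertwiningMap.id ρ) r) Q y
  have h3 : linHomMap (IntertwiningMap.id ρ) r y = f := by
    ext u
    change R (IndV.mk Q.subtype (res Q ρ) 1 (f u)) = f u
    rw [hR, inv_one, map_one, Module.End.one_apply]
  rw [h3, h] at h2
  exact LinearMap.congr_fun h2 u

/-- Higman's criterion, necessity. -/
theorem exists_relTrace_eq_id_of_isSummand_ind {Q : Subgroup G} {ρ : Representation k G V}
    {σ : Representation k Q U} (h : IsSummand ρ (ind Q.subtype σ)) :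
    ∃ f ∈ (res Q (linHom ρ ρ)).invariants, relTrace Q (linHom ρ ρ) f = LinearMap.id := by
  classical
  obtain ⟨i, r, hir⟩ := isSummand_iff_exists_retraction.1 h
  let e : IndV Q.subtype σ →ₗ[k] IndV Q.subtype σ :=
    indLift (fun g => if g ∈ Q then IndV.mk Q.subtype σ g else 0) (fun q g u => by
      have : Q.subtype q * g ∈ Q ↔ g ∈ Q := Subgroup.mul_mem_cancel_left Q q.2
      simp only [this]
      split_ifs
      · exact indV_mk_mul q g u
      · rfl)
  have he : ∀ g u, e (IndV.mk Q.subtype σ g u) = if g ∈ Q then IndV.mk Q.subtype σ g u else 0 := by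
    intro g u
    refine (indLift_mk _ _ g u).trans ?_
    split_ifs <;> rfl
  have hg : ∀ g x u, linHom (ind Q.subtype σ) (ind Q.subtype σ) g e (IndV.mk Q.subtype σ x u) =
      if x * g ∈ Q then IndV.mk Q.subtype σ x u else 0 := by
    intro g x u
    rw [linHom_apply, LinearMap.comp_apply, LinearMap.comp_apply, ind_mk, inv_inv, he]
    split_ifs
    · rw [ind_mk, mul_inv_cancel_right]
    · exact map_zero _
  have heQ : e ∈ (res Q (linHom (ind Q.subtype σ) (ind Q.subtype σ))).invariants := by
    intro q
    refine IndV.hom_ext _ _ fun x => LinearMap.ext fun u => ?_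
    refine (hg q x u).trans ?_
    refine Eq.trans ?_ (he x u).symm
    simp only [Subgroup.mul_mem_cancel_right Q q.2]
  have htr : relTrace Q (linHom (ind Q.subtype σ) (ind Q.subtype σ)) e = LinearMap.id := by
    have := Fintype.ofFinite (G ⧸ Q)
    refine IndV.hom_ext _ _ fun x => LinearMap.ext fun u => ?_
    rw [relTrace_apply, LinearMap.comp_apply, LinearMap.sum_apply,
      Finset.sum_eq_single ((x⁻¹ : G) : G ⧸ Q)]
    · rw [apply_out_of_mem_invariants heQ, hg, mul_inv_cancel, if_pos Q.one_mem]
      rfl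
    · intro c _ hc
      rw [hg, if_neg]
      intro hx
      apply hc
      rw [← QuotientGroup.out_eq' c]
      refine (QuotientGroup.eq.2 ?_).symm
      rwa [inv_inv]
    · simp
  refine ⟨linHomMap i r e, intertwiningMap_map_mem_invariants_res _ heQ, ?_⟩
  rw [← intertwiningMap_map_relTrace, htr]
  ext u
  exact hir u

end Higman

end

section

variable {k G : Type*} [Field k] [Group G]
  {U V W Y : Type*} [AddCommGroup U] [Module k U] [AddCommGroup V] [Module k V]
  [AddCommGroup W] [Module k W] [AddCommGroup Y] [Module k Y]

section Indecomposable

variable {ρ : Representation k G V}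

/-- Fitting's lemma for endomorphisms of an indecomposable representation. -/
theorem IsIndecomposable.bijective_or_isNilpotent [FiniteDimensional k V]
    (hρ : IsIndecomposable ρ) (f : IntertwiningMap ρ ρ) :
    Function.Bijective f ∨ IsNilpotent f.toLinearMap := by
  obtain ⟨n, hn, hn1⟩ := ((f.toLinearMap.eventually_isCompl_ker_pow_range_pow).and
    (Filter.eventually_ge_atTop 1)).exists
  have hcomm : ∀ g v, (f.toLinearMap ^ n) (ρ g v) = ρ g ((f.toLinearMap ^ n) v) := by
    intro g v
    have : Commute f.toLinearMap (ρ g) := LinearMap.ext fun v => intertwiningMap_comm f g v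
    exact LinearMap.congr_fun (this.pow_left n) v
  let A : Subrepresentation ρ := ⟨LinearMap.ker (f.toLinearMap ^ n), fun g v hv => by
    rw [LinearMap.mem_ker] at hv ⊢
    rw [hcomm, hv, map_zero]⟩
  let B : Subrepresentation ρ := ⟨LinearMap.range (f.toLinearMap ^ n), by
    rintro g _ ⟨v, rfl⟩
    exact ⟨ρ g v, hcomm g v⟩⟩
  have hAB : IsCompl A B :=
    ⟨disjoint_iff.2 (Subrepresentation.toSubmodule_injective (disjoint_iff.1 hn.disjoint)),
      codisjoint_iff.2 (Subrepresentation.toSubmodule_injective (codisjoint_iff.1 hn.codisjoint))⟩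
  rcases hρ.2 A B hAB with h | h
  · left
    have h0 : LinearMap.ker (f.toLinearMap ^ n) = ⊥ := congrArg Subrepresentation.toSubmodule h
    have hinj : Function.Injective f.toLinearMap := by
      rw [← LinearMap.ker_eq_bot, eq_bot_iff, ← h0]
      intro v hv
      obtain ⟨m, rfl⟩ := Nat.exists_eq_add_of_le' hn1
      rw [LinearMap.mem_ker] at hv ⊢
      rw [pow_succ, Module.End.mul_apply, hv, map_zero]
    exact ⟨hinj, LinearMap.surjective_of_injective hinj⟩
  · right
    have h0 : LinearMap.range (f.toLinearMap ^ n) = ⊥ := congrArg Subrepresentation.toSubmodule h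
    exact ⟨n, LinearMap.range_eq_bot.1 h0⟩

theorem not_bijective_of_isNilpotent [Nontrivial V] {f : V →ₗ[k] V} (hf : IsNilpotent f) :
    ¬ Function.Bijective f := fun hb => by
  have : IsUnit f := (Module.End.isUnit_iff f).2 hb
  exact hf.not_isUnit this

/-- The sum of two non-invertible endomorphisms of an indecomposable representation is
non-invertible. -/
theorem IsIndecomposable.not_bijective_add [FiniteDimensional k V] (hρ : IsIndecomposable ρ)
    {f g : IntertwiningMap ρ ρ} (hf : ¬ Function.Bijective f) (hg : ¬ Function.Bijective g) :
    ¬ Function.Bijective (f + g) := by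
  have := hρ.1
  intro h
  let e := (Representation.IntertwiningMap.ofBijective (f + g) h).symm.toIntertwiningMap
  have he : ∀ v, e (f v) + e (g v) = v := by
    intro v
    rw [← map_add]
    exact (Representation.IntertwiningMap.ofBijective (f + g) h).symm_apply_apply v
  have heb : Function.Bijective e :=
    (Representation.IntertwiningMap.ofBijective (f + g) h).symm.toLinearEquiv.bijective
  have h1 : ¬ Function.Bijective (e.comp f) := fun hb =>
    hf ((Function.Bijective.of_comp_iff' heb f).1 hb)
  have h2 := (hρ.bijective_or_isNilpotent (e.comp f)).resolve_left h1
  have h3 : IsUnit (1 - (e.comp f).toLinearMap) := h2.isUnit_one_sub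
  have h4 : 1 - (e.comp f).toLinearMap = (e.comp g).toLinearMap := by
    ext v
    exact sub_eq_of_eq_add' (he v).symm
  rw [h4, Module.End.isUnit_iff] at h3
  exact hg ((Function.Bijective.of_comp_iff' heb g).1 h3)

/-- Over an algebraically closed field, an indecomposable representation with an endomorphism of
nonzero trace has dimension prime to the characteristic. -/
theorem IsIndecomposable.finrank_ne_zero_of_trace_ne_zero [IsAlgClosed k] [FiniteDimensional k V]
    (hρ : IsIndecomposable ρ) (f : IntertwiningMap ρ ρ)
    (hf : LinearMap.trace k V f.toLinearMap ≠ 0) : (Module.finrank k V : k) ≠ 0 := by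
  have := hρ.1
  obtain ⟨c, hc⟩ := Module.End.exists_eigenvalue f.toLinearMap
  obtain ⟨v, hv⟩ := hc.exists_hasEigenvector
  have hnb : ¬ Function.Bijective (f - c • Representation.IntertwiningMap.id ρ) := by
    intro hb
    refine hv.2 (hb.1 (Eq.trans ?_ (map_zero _).symm))
    exact sub_eq_zero.2 hv.apply_eq_smul
  have hn := (hρ.bijective_or_isNilpotent _).resolve_left hnb
  have ht := (LinearMap.isNilpotent_trace_of_isNilpotent hn).eq_zero
  intro h0
  apply hf
  have h1 : (f - c • Representation.IntertwiningMap.id ρ).toLinearMap =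
    f.toLinearMap - c • LinearMap.id := rfl
  rw [h1, map_sub, map_smul, LinearMap.trace_id, h0, smul_zero, sub_zero] at ht
  exact ht

theorem IsIndecomposable.nonempty_equiv_of_isSummand {σ : Representation k G U}
    (hρ : IsIndecomposable ρ) [Nontrivial U] (h : IsSummand σ ρ) : Nonempty (σ.Equiv ρ) := by
  obtain ⟨A, B, hAB, ⟨e⟩⟩ := h
  rcases hρ.2 A B hAB with rfl | rfl
  · exfalso
    obtain ⟨u, hu⟩ := exists_ne (0 : U)
    refine hu (e.toLinearEquiv.injective ?_)
    rw [map_zero]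
    exact Subtype.ext ((Submodule.mem_bot k).1 (e u).2)
  · have hA : A = ⊤ := by simpa using hAB.codisjoint
    subst hA
    exact ⟨e.trans (Representation.Equiv.mk (LinearEquiv.ofTop ⊤ rfl) fun g => rfl)⟩

end Indecomposable

section Vertex

variable [Finite G] {ρ : Representation k G V}

theorem IsVertex.id_notMem_traceIdeal [FiniteDimensional k V] {S : Subgroup G}
    (hρ : IsIndecomposable ρ) (hS : IsVertex ρ S) :
    LinearMap.id ∉ traceIdeal S (linHom ρ ρ) := by
  have := hρ.1
  let N : Submodule k (V →ₗ[k] V) :=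
    { carrier := {f | f ∈ (linHom ρ ρ).invariants ∧ ¬ Function.Bijective f}
      zero_mem' := ⟨zero_mem _, not_bijective_of_isNilpotent IsNilpotent.zero⟩
      add_mem' := by
        rintro f g ⟨hf, hf'⟩ ⟨hg, hg'⟩
        let F := invariantsEquivIntertwiningMap ρ ρ ⟨f, hf⟩
        let F' := invariantsEquivIntertwiningMap ρ ρ ⟨g, hg⟩
        exact ⟨add_mem hf hg, hρ.not_bijective_add (f := F) (g := F') hf' hg'⟩
      smul_mem' := by
        rintro c f ⟨hf, hf'⟩
        refine ⟨Submodule.smul_mem _ c hf, fun hb => hf' ?_⟩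
        rw [← Module.End.isUnit_iff] at hb ⊢
        rcases eq_or_ne c 0 with rfl | hc
        · rw [zero_smul] at hb
          exact absurd hb not_isUnit_zero
        · exact (isUnit_smul_iff (Units.mk0 c hc) f).1 hb }
  suffices traceIdeal S (linHom ρ ρ) ≤ N from fun h => (this h).2 Function.bijective_id
  refine traceIdeal_le fun Q hQ f hf => ⟨relTrace_mem_invariants hf, fun hb => ?_⟩
  let F := invariantsEquivIntertwiningMap ρ ρ ⟨_, relTrace_mem_invariants hf⟩
  let e := (Representation.IntertwiningMap.ofBijective F hb).symm.toIntertwiningMap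
  have h1 := intertwiningMap_map_relTrace (linHomMap (IntertwiningMap.id ρ) e) Q f
  have h2 : linHomMap (IntertwiningMap.id ρ) e (relTrace Q (linHom ρ ρ) f) = LinearMap.id := by
    ext v
    exact (Representation.IntertwiningMap.ofBijective F hb).symm_apply_apply v
  have h3 := isSummand_ind_of_relTrace_eq_id
    (intertwiningMap_map_mem_invariants_res (linHomMap (IntertwiningMap.id ρ) e) hf)
    (h1.symm.trans h2)
  exact hQ.not_ge (hS.2 h3 hQ.le)

theorem isSummand_ind_sylow {p : ℕ} [Fact p.Prime] [CharP k p] (S : Sylow p G)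
    (ρ : Representation k G V) : IsSummand ρ (ind (S : Subgroup G).subtype (res S ρ)) := by
  have hS : ((S : Subgroup G).index : k) ≠ 0 := by
    rw [Ne, CharP.cast_eq_zero_iff k p]
    exact S.not_dvd_index
  have hid : (LinearMap.id : V →ₗ[k] V) ∈ (linHom ρ ρ).invariants :=
    mem_invariants_linHom_iff.2 fun _ _ => rfl
  have h := Submodule.smul_mem _ ((S : Subgroup G).index : k)⁻¹ hid
  refine isSummand_ind_of_relTrace_eq_id (invariants_le_invariants_res _ _ h) ?_
  rw [relTrace_of_mem_invariants _ h, smul_smul, mul_inv_cancel₀ hS, one_smul]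

/-- A representation without a given Sylow subgroup as a vertex is projective relative to a proper
subgroup of it. -/
theorem id_mem_traceIdeal_of_not_isVertex {p : ℕ} [Fact p.Prime] [CharP k p] (S : Sylow p G)
    (hS : ¬ IsVertex ρ S) : LinearMap.id ∈ traceIdeal (S : Subgroup G) (linHom ρ ρ) := by
  obtain ⟨Q, hQS, hQ⟩ := (Set.toFinite
    {K : Subgroup G | IsSummand ρ (ind K.subtype (res K ρ))}).exists_le_minimal
      (isSummand_ind_sylow S ρ)
  rcases hQS.eq_or_lt with rfl | hlt
  · exact absurd hQ hS
  · obtain ⟨f, hf, hid⟩ := exists_relTrace_eq_id_of_isSummand_ind hQ.1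
    rw [← hid]
    exact relTrace_mem_traceIdeal hlt hf

/-- If the identity of each indecomposable summand lies in the trace ideal, so does the
identity. -/
theorem id_mem_traceIdeal_of_forall_summand [FiniteDimensional k V] (S : Subgroup G)
    (h : ∀ A : Subrepresentation ρ, IsComponent A.toRepresentation ρ →
      LinearMap.id ∈ traceIdeal S (linHom A.toRepresentation A.toRepresentation)) :
    LinearMap.id ∈ traceIdeal S (linHom ρ ρ) := by
  suffices H : ∀ (n : ℕ) (A : Subrepresentation ρ), IsSummand A.toRepresentation ρ →
      Module.finrank k A.toSubmodule = n →
      LinearMap.id ∈ traceIdeal S (linHom A.toRepresentation A.toRepresentation) by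
    have htop : IsCompl (⊤ : Subrepresentation ρ) ⊥ := isCompl_top_bot
    have h1 := H _ ⊤ (isSummand_toRepresentation_of_isCompl htop) rfl
    let r : IntertwiningMap ρ (⊤ : Subrepresentation ρ).toRepresentation :=
      ⟨LinearMap.codRestrict _ LinearMap.id fun _ => Submodule.mem_top, fun g => rfl⟩
    exact intertwiningMap_map_mem_traceIdeal (linHomMap r (inclusion ⊤)) h1
  intro n
  induction n using Nat.strong_induction_on with
  | _ n ih =>
    intro A hA hn
    by_cases hind : IsIndecomposable A.toRepresentation
    · exact h A ⟨hind, hA⟩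
    by_cases hnt : Nontrivial A.toSubmodule
    · have : ∃ B C : Subrepresentation A.toRepresentation, IsCompl B C ∧ B ≠ ⊥ ∧ C ≠ ⊥ := by
        by_contra! hcon
        exact hind ⟨hnt, fun B C hBC => or_iff_not_imp_left.2 (hcon B C hBC)⟩
      obtain ⟨B, C, hBC, hB, hC⟩ := this
      have key : ∀ B C : Subrepresentation A.toRepresentation, IsCompl B C → C ≠ ⊥ →
          ∃ e ∈ traceIdeal S (linHom A.toRepresentation A.toRepresentation),
            (∀ b ∈ B, e b = b) ∧ ∀ c ∈ C, e c = 0 := by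
        intro B C hBC hC
        obtain ⟨r, hrB, hrC⟩ := exists_projection_of_isCompl hBC
        have hsum := isSummand_trans (isSummand_toRepresentation_of_isCompl hBC) hA
        obtain ⟨A', B', hc, ⟨e⟩⟩ := id hsum
        have hB : B.toSubmodule ≠ ⊤ := by
          intro h
          have hB : B = ⊤ := Subrepresentation.toSubmodule_injective h
          subst hB
          exact hC (by simpa using hBC.disjoint)
        have hlt : Module.finrank k A'.toSubmodule < n := by
          rw [← hn, ← e.toLinearEquiv.finrank_eq]
          exact Submodule.finrank_lt hB
        refine ⟨_, intertwiningMap_map_mem_traceIdeal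
          (linHomMap (e.toIntertwiningMap.comp r) ((inclusion B).comp e.symm.toIntertwiningMap))
          (ih _ hlt A' (isSummand_toRepresentation_of_isCompl hc) rfl), fun b hb => ?_,
          fun c hc => ?_⟩
        · change ((e.symm (e (r b)) : B.toSubmodule) : A.toSubmodule) = b
          rw [e.symm_apply_apply, hrB ⟨b, hb⟩]
        · change ((e.symm (e (r c)) : B.toSubmodule) : A.toSubmodule) = 0
          rw [e.symm_apply_apply, hrC c hc]
          rfl
      obtain ⟨e, he, heB, heC⟩ := key B C hBC hC
      obtain ⟨e', he', heC', heB'⟩ := key C B hBC.symm hB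
      have : LinearMap.id = e + e' := by
        ext1 a
        have ha : a ∈ B.toSubmodule ⊔ C.toSubmodule := by
          have : B.toSubmodule ⊔ C.toSubmodule = ⊤ :=
            congrArg Subrepresentation.toSubmodule (codisjoint_iff.1 hBC.codisjoint)
          rw [this]
          exact Submodule.mem_top
        obtain ⟨b, hb, c, hc, rfl⟩ := Submodule.mem_sup.1 ha
        simp [heB b hb, heC c hc, heC' c hc, heB' b hb]
      rw [this]
      exact add_mem he he'
    · rw [not_nontrivial_iff_subsingleton] at hnt
      rw [Subsingleton.elim LinearMap.id (0 : A.toSubmodule →ₗ[k] A.toSubmodule)]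
      exact zero_mem _

end Vertex

section Forms

/-- The evaluation at an invariant vector. -/
def evalMap {τ : Representation k G W} (σ : Representation k G U) {w : W} (hw : w ∈ τ.invariants) :
    IntertwiningMap (linHom τ σ) σ where
  toLinearMap := LinearMap.applyₗ w
  isIntertwining' g := by
    ext f
    change σ g (f (τ g⁻¹ w)) = σ g (f w)
    rw [hw]

/-- The rank one maps given by an invariant linear form. -/
def smulRightMap {τ : Representation k G W} (σ : Representation k G U)
    (l : IntertwiningMap τ (trivial k G k)) : IntertwiningMap σ (linHom τ σ) where
  toLinearMap := LinearMap.smulRightₗ l.toLinearMap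
  isIntertwining' g := by
    ext u w
    have h : l (τ g⁻¹ w) = l w := intertwiningMap_comm l g⁻¹ w
    change l w • σ g u = σ g (l (τ g⁻¹ w) • u)
    rw [h, map_smul]

variable {σ : Representation k G U} {ρ : Representation k G V} {υ : Representation k G Y}
  {τ : Representation k G W}

theorem linHom_smulRight (g : G) (α : Module.Dual k U) (v : V) :
    linHom σ ρ g (LinearMap.smulRight α v) = LinearMap.smulRight (α ∘ₗ σ g⁻¹) (ρ g v) := by
  ext u
  simp

/-- Invariant linear forms on `Hom(U, V)` are given by the trace pairing with `Hom_G(V, U)`. -/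
theorem exists_eq_trace_comp [FiniteDimensional k U] [FiniteDimensional k V]
    (l : IntertwiningMap (linHom σ ρ) (trivial k G k)) :
    ∃ h : IntertwiningMap ρ σ, ∀ f, l f = LinearMap.trace k V (f ∘ₗ h.toLinearMap) := by
  let b : V →ₗ[k] Module.Dual k (Module.Dual k U) :=
    (LinearMap.llcomp k _ _ _ l.toLinearMap) ∘ₗ (LinearMap.smulRightₗ).flip
  let h : V →ₗ[k] U := (Module.evalEquiv k U).symm.toLinearMap ∘ₗ b
  have hh : ∀ (α : Module.Dual k U) v, α (h v) = l (LinearMap.smulRight α v) := by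
    intro α v
    exact Module.apply_evalEquiv_symm_apply k U α (b v)
  have hG : ∀ g v, h (ρ g v) = σ g (h v) := by
    intro g v
    refine (Module.forall_dual_apply_eq_zero_iff k _).1 (fun α => ?_) |> sub_eq_zero.1
    rw [map_sub, sub_eq_zero, hh, show α (σ g (h v)) = (α ∘ₗ σ g) (h v) from rfl, hh]
    have := intertwiningMap_comm l g (LinearMap.smulRight (α ∘ₗ σ g) v)
    rw [linHom_smulRight, LinearMap.comp_assoc, ← Module.End.mul_eq_comp (σ g), ← map_mul,
      mul_inv_cancel, map_one] at this
    exact this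
  refine ⟨⟨h, fun g => LinearMap.ext (hG g)⟩, fun f => ?_⟩
  suffices l.toLinearMap ∘ₗ (dualTensorHomEquiv k U V).toLinearMap =
      (LinearMap.trace k V ∘ₗ LinearMap.lcomp k V h) ∘ₗ (dualTensorHomEquiv k U V).toLinearMap by
    have := LinearMap.congr_fun this ((dualTensorHomEquiv k U V).symm f)
    simp only [LinearMap.comp_apply, LinearEquiv.coe_coe, LinearEquiv.apply_symm_apply] at this
    exact this
  refine TensorProduct.ext' fun α v => ?_
  have h1 : dualTensorHomEquiv k U V (TensorProduct.tmul k α v) = LinearMap.smulRight α v := by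
    ext u
    simp
  have h2 : (LinearMap.smulRight α v) ∘ₗ h = LinearMap.smulRight (α ∘ₗ h) v := rfl
  change l (dualTensorHomEquiv k U V (TensorProduct.tmul k α v)) =
    LinearMap.trace k V (dualTensorHomEquiv k U V (TensorProduct.tmul k α v) ∘ₗ h)
  rw [h1, h2, LinearMap.trace_smulRight]
  exact (hh α v).symm

variable [Finite G] {S : Subgroup G}

theorem invariants_le_traceIdeal (hτ : LinearMap.id ∈ traceIdeal S (linHom τ τ)) :
    τ.invariants ≤ traceIdeal S τ := fun _ hw =>
  intertwiningMap_map_mem_traceIdeal (evalMap τ hw) hτ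

section Decomposition

variable {n : ℕ} {a₁ : IntertwiningMap υ (trivial k G (Fin n → k))}
  {b₁ : IntertwiningMap (trivial k G (Fin n → k)) υ}
  {a₂ : IntertwiningMap υ τ} {b₂ : IntertwiningMap τ υ}

/-- The coordinates of a homomorphism to a trivial representation. -/
def coordForm (a : IntertwiningMap υ (trivial k G (Fin n → k))) (j : Fin n) :
    IntertwiningMap υ (trivial k G k) where
  toLinearMap := LinearMap.proj j ∘ₗ a.toLinearMap
  isIntertwining' g := by
    ext y
    exact congrFun (intertwiningMap_comm a g y) j

theorem exists_form_eq_one (h : ∀ y, b₁ (a₁ y) + b₂ (a₂ y) = y)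
    (hτ : LinearMap.id ∈ traceIdeal S (linHom τ τ)) {y : Y} (hy : y ∈ υ.invariants)
    (hyS : y ∉ traceIdeal S υ) : ∃ l : IntertwiningMap υ (trivial k G k), l y = 1 := by
  have h1 : a₁ y ≠ 0 := by
    intro h0
    apply hyS
    have hy' := h y
    rw [h0, map_zero, zero_add] at hy'
    rw [← hy']
    refine intertwiningMap_map_mem_traceIdeal b₂ (invariants_le_traceIdeal hτ fun g => ?_)
    rw [← intertwiningMap_comm a₂, hy g]
  obtain ⟨j, hj⟩ := Function.ne_iff.1 h1
  exact ⟨(a₁ y j)⁻¹ • coordForm a₁ j, inv_mul_cancel₀ hj⟩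

theorem id_mem_traceIdeal_of_invariants_le (h : ∀ y, b₁ (a₁ y) + b₂ (a₂ y) = y)
    (hτ : LinearMap.id ∈ traceIdeal S (linHom τ τ)) (hy : υ.invariants ≤ traceIdeal S υ) :
    LinearMap.id ∈ traceIdeal S (linHom υ υ) := by
  have h1 : (LinearMap.id : Y →ₗ[k] Y) = (∑ j, smulRightMap υ (coordForm a₁ j)
      (b₁ (Pi.single j 1))) + linHomMap a₂ b₂ LinearMap.id := by
    ext y
    have h2 : a₁ y = ∑ j, a₁ y j • Pi.single j (1 : k) := by
      simp [← Pi.single_smul, Finset.univ_sum_single]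
    have h3 := h y
    rw [h2, map_sum] at h3
    simp only [map_smul] at h3
    rw [LinearMap.add_apply, LinearMap.sum_apply]
    exact h3.symm
  rw [h1]
  refine add_mem (sum_mem fun j _ => ?_) (intertwiningMap_map_mem_traceIdeal _ hτ)
  refine intertwiningMap_map_mem_traceIdeal _ (hy fun g => ?_)
  rw [← intertwiningMap_comm b₁]
  rfl

end Decomposition

end Forms

section PartialTrace

variable [FiniteDimensional k U]

/-- The contraction of bilinear maps on `U* × U`. -/
noncomputable def contraction : (Module.Dual k U →ₗ[k] U →ₗ[k] V) →ₗ[k] V :=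
  LinearMap.applyₗ ((dualTensorHomEquiv k U U).symm LinearMap.id) ∘ₗ
    (TensorProduct.uncurry (RingHom.id k) (Module.Dual k U) U V)

/-- The contraction `End(Hom(U, V)) → End(V)` over `U`. -/
noncomputable def partialTrace : ((U →ₗ[k] V) →ₗ[k] (U →ₗ[k] V)) →ₗ[k] V →ₗ[k] V :=
  LinearMap.llcomp k _ _ _ contraction ∘ₗ LinearMap.lcomp k _ LinearMap.smulRightₗ.flip ∘ₗ
    LinearMap.llcomp k _ _ _

theorem partialTrace_apply (θ : (U →ₗ[k] V) →ₗ[k] (U →ₗ[k] V)) (v : V) :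
    partialTrace θ v = TensorProduct.lift (θ ∘ₗ LinearMap.smulRightₗ.flip v)
        ((dualTensorHomEquiv k U U).symm LinearMap.id) := rfl

theorem map_dual_dualTensorHomEquiv_symm_id (σ : Representation k G U) (g : G) :
    TensorProduct.map (dual σ g) (σ g) ((dualTensorHomEquiv k U U).symm LinearMap.id) =
      (dualTensorHomEquiv k U U).symm LinearMap.id := by
  have h1 := LinearMap.congr_fun (dualTensorHom_comm σ σ g)
    ((dualTensorHomEquiv k U U).symm LinearMap.id)
  have h2 := (dualTensorHomEquiv k U U).apply_symm_apply LinearMap.id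
  apply (dualTensorHomEquiv k U U).injective
  refine h1.trans (Eq.trans (congrArg (linHom σ σ g) h2) (Eq.trans ?_ h2.symm))
  exact mem_invariants_linHom_iff.2 (fun _ _ => rfl) g

theorem partialTrace_id :
    partialTrace (LinearMap.id : (U →ₗ[k] V) →ₗ[k] (U →ₗ[k] V)) =
      (Module.finrank k U : k) • LinearMap.id := by
  ext v
  rw [partialTrace_apply]
  have h : TensorProduct.lift (LinearMap.id ∘ₗ LinearMap.smulRightₗ.flip v) =
      LinearMap.toSpanSingleton k V v ∘ₗ contractLeft k U := by
    refine TensorProduct.ext' fun α u => ?_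
    simp
  have h2 := (dualTensorHomEquiv k U U).apply_symm_apply LinearMap.id
  have h3 := LinearMap.trace_eq_contract_apply k U
    ((dualTensorHomEquiv k U U).symm (LinearMap.id : U →ₗ[k] U))
  rw [h, LinearMap.comp_apply, ← LinearMap.trace_id k U, ← h3]
  exact congrArg (fun f => LinearMap.trace k U f • v) h2

/-- The partial trace as a homomorphism of representations. -/
noncomputable def partialTraceMap (σ : Representation k G U) (ρ : Representation k G V) :
    IntertwiningMap (linHom (linHom σ ρ) (linHom σ ρ)) (linHom ρ ρ) where
  toLinearMap := partialTrace
  isIntertwining' g := by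
    ext θ v
    have h : TensorProduct.lift ((linHom (linHom σ ρ) (linHom σ ρ) g θ) ∘ₗ
        LinearMap.smulRightₗ.flip v) = ρ g ∘ₗ TensorProduct.lift
          (θ ∘ₗ LinearMap.smulRightₗ.flip (ρ g⁻¹ v)) ∘ₗ
            TensorProduct.map (dual σ g⁻¹) (σ g⁻¹) := by
      refine TensorProduct.ext' fun α u => ?_
      change ρ g (θ (linHom σ ρ g⁻¹ (LinearMap.smulRight α v)) (σ g⁻¹ u)) =
        ρ g (θ (LinearMap.smulRight (α ∘ₗ σ g⁻¹⁻¹) (ρ g⁻¹ v)) (σ g⁻¹ u))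
      rw [linHom_smulRight]
    change TensorProduct.lift ((linHom (linHom σ ρ) (linHom σ ρ) g θ) ∘ₗ
        LinearMap.smulRightₗ.flip v) ((dualTensorHomEquiv k U U).symm LinearMap.id) =
      ρ g (TensorProduct.lift (θ ∘ₗ LinearMap.smulRightₗ.flip (ρ g⁻¹ v))
        ((dualTensorHomEquiv k U U).symm LinearMap.id))
    rw [h, LinearMap.comp_apply, LinearMap.comp_apply, map_dual_dualTensorHomEquiv_symm_id]

end PartialTrace

end

section

variable {k G : Type*} [Field k] [Group G] [Finite G] {p : ℕ} [Fact p.Prime] [CharP k p]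
  {U V M : Type*} [AddCommGroup U] [Module k U] [AddCommGroup V] [Module k V]
  [AddCommGroup M] [Module k M] [FiniteDimensional k M]

omit [Finite G] in
theorem finiteDimensional_of_isSummand {σ : Representation k G U} {ρ : Representation k G M}
    (h : IsSummand σ ρ) : FiniteDimensional k U := by
  obtain ⟨i, r, hir⟩ := isSummand_iff_exists_retraction.1 h
  exact Module.Finite.of_injective i.toLinearMap (Function.LeftInverse.injective hir)

omit [Finite G] [FiniteDimensional k M] in
theorem IsSummand.linHom {σ : Representation k G U} {τ : Representation k G V}
    {ρ : Representation k G M} (h : IsSummand σ ρ) (h' : IsSummand τ ρ) :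
    IsSummand (linHom σ τ) (linHom ρ ρ) := by
  obtain ⟨i, r, hir⟩ := isSummand_iff_exists_retraction.1 h
  obtain ⟨i', r', hir'⟩ := isSummand_iff_exists_retraction.1 h'
  refine isSummand_iff_exists_retraction.2 ⟨linHomMap r i', linHomMap i r', fun f => ?_⟩
  ext u
  change r' (i' (f (r (i u)))) = f u
  rw [hir, hir']

/-- Two properties of the summands of the endomorphism module of a Dade module: an invariant vector
outside the trace ideal is detected by an invariant linear form, and if all invariants lie in the
trace ideal, then so does the identity. -/
theorem IsDade.summand_properties {ρ : Representation k G M} (hρ : IsDade p ρ) (S : Sylow p G)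
    {υ : Representation k G U} (hυ : IsSummand υ (linHom ρ ρ)) :
    (∀ y ∈ υ.invariants, y ∉ traceIdeal (S : Subgroup G) υ →
      ∃ l : IntertwiningMap υ (trivial k G k), l y = 1) ∧
    (υ.invariants ≤ traceIdeal (S : Subgroup G) υ →
      LinearMap.id ∈ traceIdeal (S : Subgroup G) (linHom υ υ)) := by
  obtain ⟨n, W, _, _, τ, ⟨e⟩, -, hW⟩ := hρ
  have : FiniteDimensional k ((Fin n → k) × W) := Module.Finite.equiv e.toLinearEquiv
  have : FiniteDimensional k W := Module.Finite.of_surjective (LinearMap.snd k (Fin n → k) W)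
    LinearMap.snd_surjective
  have hτ : LinearMap.id ∈ traceIdeal (S : Subgroup G) (linHom τ τ) := by
    refine id_mem_traceIdeal_of_forall_summand (S : Subgroup G) fun A hA => ?_
    have hS : ¬ IsVertex A.toRepresentation (S : Subgroup G) := fun hS => hW A ⟨hA, S, hS⟩
    exact id_mem_traceIdeal_of_not_isVertex (ρ := A.toRepresentation) S hS
  obtain ⟨i, r, hir⟩ := isSummand_iff_exists_retraction.1 hυ
  let a := e.toIntertwiningMap.comp i
  let b := r.comp e.symm.toIntertwiningMap
  let a₁ := (Representation.IntertwiningMap.fst k (trivial k G (Fin n → k)) τ).comp a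
  let b₁ := b.comp (Representation.IntertwiningMap.inl k (trivial k G (Fin n → k)) τ)
  let a₂ := (Representation.IntertwiningMap.snd k (trivial k G (Fin n → k)) τ).comp a
  let b₂ := b.comp (Representation.IntertwiningMap.inr k (trivial k G (Fin n → k)) τ)
  have h : ∀ y, b₁ (a₁ y) + b₂ (a₂ y) = y := by
    intro y
    have h1 : b ((a y).1, 0) + b (0, (a y).2) = b (a y) := by
      rw [← map_add, Prod.mk_add_mk, add_zero, zero_add]
    have h2 : b (a y) = r (i y) := congrArg r (e.symm_apply_apply (i y))
    exact h1.trans (h2.trans (hir y))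
  exact ⟨fun y hy hyS => exists_form_eq_one (a₁ := a₁) (b₁ := b₁) (a₂ := a₂) (b₂ := b₂) h hτ hy hyS,
    fun hy => id_mem_traceIdeal_of_invariants_le (a₁ := a₁) (b₁ := b₁) (a₂ := a₂) (b₂ := b₂) h hτ hy⟩

/-- For summands `U`, `V` of a Dade module, a homomorphism `U → V` outside the trace ideal has
nonzero trace pairing with some homomorphism `V → U`. -/
theorem IsDade.exists_trace_comp_eq_one {ρ : Representation k G M} (hρ : IsDade p ρ)
    (S : Sylow p G) {σ : Representation k G U} {τ : Representation k G V} (hσ : IsSummand σ ρ)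
    (hτ : IsSummand τ ρ) (f : IntertwiningMap σ τ)
    (hf : f.toLinearMap ∉ traceIdeal (S : Subgroup G) (linHom σ τ)) :
    ∃ h : IntertwiningMap τ σ, LinearMap.trace k V (f.comp h).toLinearMap = 1 := by
  have := finiteDimensional_of_isSummand hσ
  have := finiteDimensional_of_isSummand hτ
  obtain ⟨l, hl⟩ := (hρ.summand_properties S (hσ.linHom hτ)).1 _
    (intertwiningMap_mem_invariants f) hf
  obtain ⟨h, hh⟩ := exists_eq_trace_comp l
  exact ⟨h, (hh _).symm.trans hl⟩

theorem IsDade.finrank_ne_zero [IsAlgClosed k] {ρ : Representation k G M} (hρ : IsDade p ρ)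
    {σ : Representation k G U} (hσ : IsSylowVertexComponent p σ ρ) :
    (Module.finrank k U : k) ≠ 0 := by
  obtain ⟨⟨hind, hsum⟩, S, hS⟩ := hσ
  have := finiteDimensional_of_isSummand hsum
  obtain ⟨h, hh⟩ := hρ.exists_trace_comp_eq_one S hsum hsum (IntertwiningMap.id σ)
    (hS.id_notMem_traceIdeal hind)
  exact hind.finrank_ne_zero_of_trace_ne_zero h (hh.trans_ne one_ne_zero)

/-- Sylow-vertex components of a Dade module are isomorphic. -/
theorem IsDade.nonempty_equiv [IsAlgClosed k] {ρ : Representation k G M} (hρ : IsDade p ρ)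
    {σ : Representation k G U} {τ : Representation k G V} (hσ : IsSylowVertexComponent p σ ρ)
    (hτ : IsSylowVertexComponent p τ ρ) : Nonempty (σ.Equiv τ) := by
  have hdim := hρ.finrank_ne_zero hσ
  obtain ⟨⟨hσi, hσs⟩, -⟩ := hσ
  obtain ⟨⟨hτi, hτs⟩, S, hS⟩ := hτ
  have := finiteDimensional_of_isSummand hσs
  have := finiteDimensional_of_isSummand hτs
  have := hσi.1
  have := hτi.1
  have hnot : ¬ (linHom σ τ).invariants ≤ traceIdeal (S : Subgroup G) (linHom σ τ) := by
    intro hle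
    have h1 := (hρ.summand_properties S (hσs.linHom hτs)).2 hle
    have h2 := intertwiningMap_map_mem_traceIdeal (partialTraceMap σ τ) h1
    have h3 : partialTraceMap σ τ LinearMap.id = (Module.finrank k U : k) • LinearMap.id :=
      partialTrace_id
    rw [h3, Submodule.smul_mem_iff _ hdim] at h2
    exact hS.id_notMem_traceIdeal hτi h2
  obtain ⟨f, hf, hfS⟩ := SetLike.not_le_iff_exists.1 hnot
  obtain ⟨h, hh⟩ := hρ.exists_trace_comp_eq_one S hσs hτs
    (invariantsEquivIntertwiningMap σ τ ⟨f, hf⟩) hfS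
  let F := invariantsEquivIntertwiningMap σ τ ⟨f, hf⟩
  have hb : Function.Bijective (F.comp h) := by
    refine (hτi.bijective_or_isNilpotent (F.comp h)).resolve_right fun hn => ?_
    have ht := (LinearMap.isNilpotent_trace_of_isNilpotent hn).eq_zero
    exact one_ne_zero (hh.symm.trans ht)
  let e := Representation.IntertwiningMap.ofBijective (F.comp h) hb
  obtain ⟨E⟩ := hσi.nonempty_equiv_of_isSummand (isSummand_iff_exists_retraction.2
    ⟨h, e.symm.toIntertwiningMap.comp F, fun v => e.symm_apply_apply v⟩)
  exact ⟨E.symm⟩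

end

end DadeModule

theorem mainTheorem9
    {k : Type*} [Field k] [IsAlgClosed k] (p : ℕ) [Fact p.Prime] [CharP k p]
    {G : Type*} [Group G] [Finite G]
    {M : Type*} [AddCommGroup M] [Module k M] [FiniteDimensional k M]
    (ρ : Representation k G M) (hρ : DadeModule.IsCappedDade p ρ) :
    (∀ (U : Type*) [AddCommGroup U] [Module k U] (σ : Representation k G U)
      (V : Type*) [AddCommGroup V] [Module k V] (τ : Representation k G V),
      DadeModule.IsSylowVertexComponent p σ ρ → DadeModule.IsSylowVertexComponent p τ ρ →
        Nonempty (σ.Equiv τ)) ∧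
    (∃ C : Subrepresentation ρ,
      DadeModule.IsSylowVertexComponent p C.toRepresentation ρ ∧
      ∀ (U : Type*) [AddCommGroup U] [Module k U] (σ : Representation k G U),
        DadeModule.IsSylowVertexComponent p σ ρ → Nonempty (σ.Equiv C.toRepresentation)) := by

  obtain ⟨hd, C, hC⟩ := hρ
  exact ⟨fun U _ _ σ V _ _ τ hσ hτ => hd.nonempty_equiv hσ hτ,
    C, hC, fun U _ _ σ hσ => hd.nonempty_equiv hσ hC⟩
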